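/- A string $w\in\{0,1\}^n$ has slots $1,\dots,n$; slot $i$ is honest if $w_i=0$ and adversarial if $w_i=1$. A fork $F\vdash w$ is a finite rooted tree with edges directed away from the root and a vertex labelling $\ell:V\to\{0,\dots,n\}$ such that the root has label $0$, labels strictly increase along directed paths, each honest slot is the label of exactly one vertex, and the depths of these (honest) vertices strictly increase with their labels. $F$ is closed if every leaf is honest (the one-vertex fork is closed as well). A tine is a directed path starting at the root; its length is its number of edges. For a tine $t$ with last vertex $v$ in a closed fork $F\vdash w$, $\mathrm{reach}(t)$ is the number of adversarial slots $i>\ell(v)$ of $w$, minus the difference between the length of a longest tine of $F$ and the length of $t$. For strings $x,y$, the relative margin $\mu_x(y)$ is the maximum of $\min\{\mathrm{reach}(t_1),\mathrm{reach}(t_2)\}$ over all closed forks $F\vdash xy$ and all pairs of tines $t_1,t_2$ of $F$ (possibly equal) that share no edge terminating at a vertex labelled by a slot of $y$, i.e. with label $>|x|$. A random variable $w=(w_1,\dots,w_T)$ with values in $\{0,1\}^T$ satisfies the $\epsilon$-martingale condition if $\mathbb{E}[w_t\mid w_1,\dots,w_{t-1}]\le(1-\epsilon)/2$ almost surely for each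 $t\in\{1,\dots,T\}$. **Corollary.** For every $\epsilon\in(0,1)$ there are constants $C,c>0$, depending only on $\epsilon$, such that for all $T,s,k\in\mathbb{N}$ and every random variable $w\in\{0,1\}^T$ satisfying the $\epsilon$-martingale condition, $$\Pr_w\bigl[\text{there is a decomposition } w=xyz \text{ with } |x|=s-1,\ |y|\ge k \text{ and } \mu_x(y)\ge 0\bigr]\le C\,e^{-ck}.$$ -/

import Mathlib

open MeasureTheory

/-! Characteristic strings are lists of Booleans, `true` being the symbol `1` (adversarial slot) and
`false` the symbol `0` (honest slot). Slots are numbered from `1`. -/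

/-- Slot `i` of `w` is honest: `i ∈ {1, …, |w|}` and `w_i = 0`. -/
def HonestSlot (w : List Bool) (i : ℕ) : Prop := 1 ≤ i ∧ w[i - 1]? = some false

/-- Slot `i` of `w` is adversarial: `i ∈ {1, …, |w|}` and `w_i = 1`. -/
def AdvSlot (w : List Bool) (i : ℕ) : Prop := 1 ≤ i ∧ w[i - 1]? = some true

instance (w : List Bool) : DecidablePred (AdvSlot w) :=
  fun i => inferInstanceAs (Decidable (1 ≤ i ∧ w[i - 1]? = some true))

/-- A finite rooted tree with a vertex labelling which is `0` at the root and strictly increasing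
along directed paths. The tree is given by its parent map: its edges, directed away from the root,
are the pairs `parent v → v` with `v ≠ root` (the value of `parent` at the root carries no
information). Since labels decrease along `parent`, every vertex is reached from the root. -/
structure LabeledTree where
  /-- the vertices -/
  V : Type
  [fintypeV : Fintype V]
  /-- the root -/
  root : V
  /-- the parent of a non-root vertex -/
  parent : V → V
  parent_root : parent root = root
  /-- the labelling -/
  label : V → ℕ
  label_root : label root = 0
  label_parent_lt : ∀ v, v ≠ root → label (parent v) < label v

attribute [instance] LabeledTree.fintypeV

namespace LabeledTree

variable (F : LabeledTree)

/-! A tine is a directed path that starts at the root. As the graph is a tree, it is determined by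
its last vertex, and we identify the two. -/

/-- The vertex `u` lies on the tine that ends at `t`. -/
def OnTine (u t : F.V) : Prop := ∃ i : ℕ, F.parent^[i] t = u

/-- Depth of the vertex `t`: the number of edges of the tine that ends at `t`. -/
noncomputable def depth (t : F.V) : ℕ := sInf {n : ℕ | F.parent^[n] t = F.root}

/-- The length of a longest tine. -/
noncomputable def height : ℕ := Finset.univ.sup F.depth

/-- `v` is a leaf: it has no children. -/
def IsLeaf (v : F.V) : Prop := ∀ u, u ≠ F.root → F.parent u ≠ v

/-- The tines `t₁` and `t₂` share no edge that terminates at a vertex with label `> m`. (An edge is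
named by the non-root vertex at which it terminates.) -/
def DisjointAfter (m : ℕ) (t₁ t₂ : F.V) : Prop :=
  ¬ ∃ u, u ≠ F.root ∧ m < F.label u ∧ F.OnTine u t₁ ∧ F.OnTine u t₂

end LabeledTree

/-- A fork for the characteristic string `w`. -/
structure Fork (w : List Bool) extends LabeledTree where
  label_le : ∀ v, label v ≤ w.length
  /-- each honest slot is the label of exactly one vertex -/
  honest_unique : ∀ i, HonestSlot w i → ∃! v, label v = i
  /-- the depths of honest vertices strictly increase with their labels -/
  honest_depth : ∀ u v, HonestSlot w (label u) → HonestSlot w (label v) →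
    label u < label v → toLabeledTree.depth u < toLabeledTree.depth v

namespace Fork

variable {w : List Bool} (F : Fork w)

/-- A fork is closed if every leaf is honest; the trivial fork is closed, too. -/
def Closed : Prop :=
  (∀ v, F.IsLeaf v → HonestSlot w (F.label v)) ∨ ∀ v, v = F.root

/-- The number of edges by which the tine `t` is shorter than a longest tine. -/
noncomputable def gap (t : F.V) : ℤ := (F.height : ℤ) - (F.depth t : ℤ)

/-- The number of adversarial slots after the last vertex of `t`. -/
def reserve (t : F.V) : ℕ :=
  ((Finset.Icc 1 w.length).filter fun i => AdvSlot w i ∧ F.label t < i).card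

/-- `reach = reserve - gap` -/
noncomputable def reach (t : F.V) : ℤ := (F.reserve t : ℤ) - F.gap t

/-- The values `min (reach t₁) (reach t₂)` over the pairs of tines which are disjoint over the part
of the string after its first `m` symbols. -/
def pairReaches (m : ℕ) : Set ℤ :=
  {r | ∃ t₁ t₂ : F.V, F.DisjointAfter m t₁ t₂ ∧ r = min (F.reach t₁) (F.reach t₂)}

/-- The relative margin `μ_x(F)` of a fork `F` for `xy`, where `m = |x|`. -/
noncomputable def relMargin (m : ℕ) : ℤ := sSup (F.pairReaches m)

end Fork

/-- The relative margins `μ_x(F)` of the closed forks `F` for `xy`. -/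
def closedMargins (x y : List Bool) : Set ℤ :=
  {r | ∃ F : Fork (x ++ y), F.Closed ∧ r = F.relMargin x.length}

/-- The relative margin `μ_x(y)`: the maximum of `μ_x(F)` over the closed forks `F` for `xy`. -/
noncomputable def relMargin (x y : List Bool) : ℤ := sSup (closedMargins x y)

/-- The `ε`-martingale condition for a random variable `W = (W_1, …, W_T)` with values in `{0,1}^T`:
`E[W_t | W_1, …, W_{t-1}] ≤ (1 - ε) / 2` almost surely, for each `t`. -/
def EpsMartingale {Ω : Type*} [MeasurableSpace Ω] (P : Measure Ω) {T : ℕ}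
    (W : Ω → Fin T → Bool) (ε : ℝ) : Prop :=
  ∀ t : Fin T,
    P[fun ω => if W ω t = true then (1 : ℝ) else 0 |
      MeasurableSpace.comap (fun ω (i : {i : Fin T // i < t}) => W ω i) inferInstance]
      ≤ᵐ[P] fun _ => (1 - ε) / 2

/-! The maxima above are attained. -/

namespace LabeledTree

variable (F : LabeledTree)

theorem exists_iterate_parent (t : F.V) : ∃ n, F.parent^[n] t = F.root := by
  induction h : F.label t using Nat.strong_induction_on generalizing t with
  | _ k ih =>
    by_cases ht : t = F.root
    · exact ⟨0, ht⟩
    · obtain ⟨n, hn⟩ := ih _ (h ▸ F.label_parent_lt t ht) (F.parent t) rfl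
      exact ⟨n + 1, hn⟩

theorem depth_root : F.depth F.root = 0 :=
  Nat.sInf_eq_zero.2 (Or.inl rfl)

theorem depth_of_ne_root {t : F.V} (ht : t ≠ F.root) :
    F.depth t = F.depth (F.parent t) + 1 := by
  have h1 : F.parent^[F.depth t] t = F.root := Nat.sInf_mem (F.exists_iterate_parent t)
  have h2 : F.parent^[F.depth (F.parent t)] (F.parent t) = F.root :=
    Nat.sInf_mem (F.exists_iterate_parent (F.parent t))
  apply le_antisymm
  · exact Nat.sInf_le h2
  · cases hd : F.depth t with
    | zero => rw [hd] at h1; exact absurd h1 ht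
    | succ n =>
      rw [hd] at h1
      have h3 : F.depth (F.parent t) ≤ n := Nat.sInf_le h1
      omega

theorem depth_le_height (t : F.V) : F.depth t ≤ F.height :=
  Finset.le_sup (f := F.depth) (Finset.mem_univ t)

end LabeledTree

namespace Fork

variable {w : List Bool} (F : Fork w)

theorem reach_le (t : F.V) : F.reach t ≤ w.length := by
  have h1 : F.reserve t ≤ w.length := by
    refine (Finset.card_filter_le _ _).trans ?_
    simp
  have h2 := F.depth_le_height t
  simp only [reach, gap]
  omega

theorem isGreatest_relMargin (m : ℕ) : IsGreatest (F.pairReaches m) (F.relMargin m) := by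
  have hb : BddAbove (F.pairReaches m) := by
    refine ⟨w.length, ?_⟩
    rintro r ⟨t₁, t₂, -, rfl⟩
    exact (min_le_left _ _).trans (F.reach_le t₁)
  have hn : (F.pairReaches m).Nonempty := by
    refine ⟨_, F.root, F.root, ?_, rfl⟩
    rintro ⟨u, hu, -, ⟨i, hi⟩, -⟩
    exact hu (hi.symm.trans (Function.iterate_fixed F.parent_root i))
  exact ⟨Int.csSup_mem hn hb, fun r hr => le_csSup hb hr⟩

open Classical in
/-- The fork that consists of a single path through the honest slots. -/
theorem exists_closed (w : List Bool) : ∃ F : Fork w, F.Closed := by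
  let S : Finset ℕ := (Finset.range (w.length + 1)).filter fun i => i = 0 ∨ HonestSlot w i
  have hS : ∀ {i}, i ∈ S ↔ i = 0 ∨ HonestSlot w i := by
    intro i
    simp only [S, Finset.mem_filter, Finset.mem_range, and_iff_right_iff_imp]
    rintro (rfl | ⟨h1, h2⟩)
    · omega
    · have := (List.getElem?_eq_some_iff.1 h2).1
      omega
  have h0 : 0 ∈ S := hS.2 (Or.inl rfl)
  have hne : ∀ i : ℕ, i ≠ 0 → (S.filter fun j => j < i).Nonempty := fun i hi =>
    ⟨0, Finset.mem_filter.2 ⟨h0, Nat.pos_of_ne_zero hi⟩⟩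
  let par : S → S := fun v =>
    if h : (v : ℕ) = 0 then v else
      ⟨(S.filter fun j => j < (v : ℕ)).max' (hne v h),
        (Finset.mem_filter.1 (Finset.max'_mem _ (hne v h))).1⟩
  have hlt : ∀ v : S, (v : ℕ) ≠ 0 → (par v : ℕ) < v := by
    intro v h
    simp only [par, dif_neg h]
    exact (Finset.mem_filter.1 (Finset.max'_mem _ (hne v h))).2
  have hmax : ∀ u v : S, (u : ℕ) < v → (u : ℕ) ≤ par v := by
    intro u v h
    have hv : (v : ℕ) ≠ 0 := by omega
    simp only [par, dif_neg hv]
    exact Finset.le_max' _ _ (Finset.mem_filter.2 ⟨u.2, h⟩)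
  let G : LabeledTree :=
    { V := S
      root := ⟨0, h0⟩
      parent := par
      parent_root := by simp [par]
      label := fun v => v
      label_root := rfl
      label_parent_lt := fun v hv => hlt v fun h => hv (Subtype.ext h) }
  have hdepth : ∀ n : ℕ, ∀ u v : S, (v : ℕ) = n → (u : ℕ) < v → G.depth u < G.depth v := by
    intro n
    induction n using Nat.strong_induction_on with
    | _ n ih =>
      intro u v hv huv
      have hv0 : v ≠ G.root := fun h => by
        have : (v : ℕ) = 0 := congrArg Subtype.val h
        omega
      have h1 := G.depth_of_ne_root hv0
      rcases (hmax u v huv).eq_or_lt with h | h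
      · have : u = par v := Subtype.ext h
        have h2 : G.depth u = G.depth (G.parent v) := congrArg G.depth this
        omega
      · have := ih _ (hv ▸ hlt v (by omega)) u (par v) rfl h
        have h2 : G.depth (par v) = G.depth (G.parent v) := rfl
        omega
  refine ⟨{ G with
    label_le := fun v => ?_
    honest_unique := fun i hi => ⟨⟨i, hS.2 (Or.inr hi)⟩, rfl, fun v hv => Subtype.ext hv⟩
    honest_depth := fun u v _ _ h => hdepth v u v rfl h }, ?_⟩
  · have := (Finset.mem_filter.1 v.2).1
    rw [Finset.mem_range] at this
    exact Nat.lt_succ_iff.1 this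
  · by_cases hw : ∀ i, ¬ HonestSlot w i
    · right
      intro v
      exact Subtype.ext ((hS.1 v.2).resolve_right (hw _))
    · left
      push Not at hw
      obtain ⟨i, hi⟩ := hw
      intro v hv
      refine (hS.1 v.2).resolve_left fun h => ?_
      have hT : (S.filter fun j => 0 < j).Nonempty :=
        ⟨i, Finset.mem_filter.2 ⟨hS.2 (Or.inr hi), hi.1⟩⟩
      obtain ⟨hm1, hm2⟩ := Finset.mem_filter.1 (Finset.min'_mem _ hT)
      set c := (S.filter fun j => 0 < j).min' hT with hc
      have hcr : (⟨c, hm1⟩ : S) ≠ G.root := fun h' => by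
        have : c = 0 := congrArg Subtype.val h'
        omega
      refine hv ⟨c, hm1⟩ hcr (Subtype.ext ?_)
      rw [h]
      by_contra hpos
      have h3 : (par ⟨c, hm1⟩ : ℕ) < c := hlt ⟨c, hm1⟩ (by simpa using hm2.ne')
      have h4 : c ≤ (par ⟨c, hm1⟩ : ℕ) :=
        Finset.min'_le _ _ (Finset.mem_filter.2 ⟨(par ⟨c, hm1⟩).2, Nat.pos_of_ne_zero hpos⟩)
      omega

end Fork

theorem isGreatest_relMargin (x y : List Bool) :
    IsGreatest (closedMargins x y) (relMargin x y) := by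
  have hb : BddAbove (closedMargins x y) := by
    refine ⟨(x ++ y).length, ?_⟩
    rintro r ⟨F, -, rfl⟩
    obtain ⟨t₁, t₂, -, h⟩ := (F.isGreatest_relMargin x.length).1
    rw [h]
    exact (min_le_left _ _).trans (F.reach_le t₁)
  have hn : (closedMargins x y).Nonempty := by
    obtain ⟨F, hF⟩ := Fork.exists_closed (x ++ y)
    exact ⟨_, F, hF, rfl⟩
  exact ⟨Int.csSup_mem hn hb, fun r hr => le_csSup hb hr⟩

/-! Only an upper bound for the margin is needed. Cut a fork after each slot to the part lying below
honest vertices seen so far (`core`), and measure reach there. An adversarial slot raises reach by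
at most one. An honest slot makes the height grow, so every old tine loses at least one, and only
the tine ending at the new honest vertex can be saved, with reach at most `0`. Hence reach and
margin are dominated by the deterministic walk `marginStep` (`relMargin_le_marginWalk`): at an
honest slot the margin bound falls by one, unless it is `0` while the reach bound is positive.

For the walk `(r, m)` take the potential `r + ε⁻¹ * min 0 m`. It has negative drift in every state
that occurs: where `r` is reflected at `0` it stops drifting down, but there the margin term does
so. Bounded increments then make a small exponential moment shrink by a factor `q < 1` per slot of
`y`, starting from a value bounded uniformly in `|x|`. If the margin is nonnegative, the potential
equals `r ≥ 0` and its exponential is at least `1`. Markov's inequality gives a multiple of `q ^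
|y|`, and summing over `|y| ≥ k` gives the claim. -/

/-! ### Reach and margin walks -/

/-- The walk on the non-negative integers, reflected at `0`, that bounds the reach of tines. -/
def reachStep (r : ℤ) (b : Bool) : ℤ := if b then r + 1 else max (r - 1) 0

/-- The joint walk of the bounds for the reach and the relative margin. -/
def marginStep (s : ℤ × ℤ) (b : Bool) : ℤ × ℤ :=
  (reachStep s.1 b,
    if b then s.2 + 1 else if s.2 = 0 ∧ 0 < s.1 then 0 else s.2 - 1)

/-- The value of the reach walk after the string `x`. -/
def reachWalk (x : List Bool) : ℤ := x.foldl reachStep 0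

/-- The state of the joint walk after `x ++ y`, where the margin is started at the end of `x`. -/
def marginWalk (x y : List Bool) : ℤ × ℤ := y.foldl marginStep (reachWalk x, reachWalk x)

theorem reachWalk_append_singleton (x : List Bool) (b : Bool) :
    reachWalk (x ++ [b]) = reachStep (reachWalk x) b := by
  simp [reachWalk]

theorem marginWalk_append_singleton (x y : List Bool) (b : Bool) :
    marginWalk x (y ++ [b]) = marginStep (marginWalk x y) b := by
  simp [marginWalk]

theorem reachWalk_nonneg (x : List Bool) : 0 ≤ reachWalk x := by
  induction x using List.reverseRecOn with
  | nil => simp [reachWalk]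
  | append_singleton x b ih =>
    rw [reachWalk_append_singleton]
    cases b
    · simp [reachStep]
    · simp only [reachStep, if_true]
      omega

theorem marginWalk_fst (x y : List Bool) : (marginWalk x y).1 = reachWalk (x ++ y) := by
  induction y using List.reverseRecOn with
  | nil => simp [marginWalk]
  | append_singleton y b ih =>
    rw [marginWalk_append_singleton, ← List.append_assoc, reachWalk_append_singleton, ← ih]
    rfl

/-- Excludes states with `r = 0 < m`, in which the potential would drift upwards. -/
theorem marginWalk_snd_le_fst (x y : List Bool) : (marginWalk x y).2 ≤ (marginWalk x y).1 := by
  induction y using List.reverseRecOn with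
  | nil => simp [marginWalk]
  | append_singleton y b ih =>
    have h0 := marginWalk_fst x y ▸ reachWalk_nonneg (x ++ y)
    rw [marginWalk_append_singleton]
    cases b <;> simp only [marginStep, reachStep] <;> grind

/-! ### Prefixes of tines and disjointness -/

namespace LabeledTree

variable (F : LabeledTree)

theorem onTine_refl (t : F.V) : F.OnTine t t := ⟨0, rfl⟩

variable {F}

theorem OnTine.trans {a b c : F.V} (h₁ : F.OnTine a b) (h₂ : F.OnTine b c) : F.OnTine a c := by
  obtain ⟨i, rfl⟩ := h₁
  obtain ⟨j, rfl⟩ := h₂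
  exact ⟨i + j, Function.iterate_add_apply _ _ _ _⟩

theorem OnTine.parent_left {a b : F.V} (h : F.OnTine a b) : F.OnTine (F.parent a) b :=
  OnTine.trans ⟨1, rfl⟩ h

theorem OnTine.eq_or_label_lt {a b : F.V} (h : F.OnTine a b) :
    a = b ∨ F.label a < F.label b := by
  obtain ⟨i, rfl⟩ := h
  induction i with
  | zero => exact Or.inl rfl
  | succ i ih =>
    rw [Function.iterate_succ_apply']
    by_cases h : F.parent^[i] b = F.root
    · rw [h] at ih ⊢
      rwa [F.parent_root]
    · right
      have := F.label_parent_lt _ h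
      rcases ih with h' | h'
      · exact this.trans_eq (congrArg F.label h')
      · exact this.trans h'

theorem DisjointAfter.mono {m : ℕ} {a b a' b' : F.V} (h : F.DisjointAfter m a b)
    (ha : F.OnTine a' a) (hb : F.OnTine b' b) : F.DisjointAfter m a' b' := by
  rintro ⟨u, h0, h1, h2, h3⟩
  exact h ⟨u, h0, h1, h2.trans ha, h3.trans hb⟩

theorem DisjointAfter.symm {m : ℕ} {a b : F.V} (h : F.DisjointAfter m a b) :
    F.DisjointAfter m b a := by
  rintro ⟨u, h0, h1, h2, h3⟩
  exact h ⟨u, h0, h1, h3, h2⟩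

end LabeledTree

/-! ### Reach in the closed subforks, slot by slot -/

namespace Fork

open LabeledTree

variable {w : List Bool} (F : Fork w)

/-- The vertices of the largest closed subfork for the first `n` slots. -/
def core (n : ℕ) : Set F.V :=
  {t | t = F.root ∨ ∃ v, HonestSlot w (F.label v) ∧ F.label v ≤ n ∧ F.OnTine t v}

open Classical in
/-- The largest depth of an honest vertex among the first `n` slots. -/
noncomputable def coreHeight (n : ℕ) : ℕ :=
  (Finset.univ.filter fun v => HonestSlot w (F.label v) ∧ F.label v ≤ n).sup F.depth

/-- The number of adversarial slots up to `n` after the last vertex of `t`. -/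
def reserveTo (n : ℕ) (t : F.V) : ℕ :=
  ((Finset.Icc 1 n).filter fun i => AdvSlot w i ∧ F.label t < i).card

/-- The reach of `t` in the largest closed subfork for the first `n` slots. -/
noncomputable def reachTo (n : ℕ) (t : F.V) : ℤ :=
  (F.reserveTo n t : ℤ) + F.depth t - F.coreHeight n

theorem coreHeight_mono {m n : ℕ} (h : m ≤ n) : F.coreHeight m ≤ F.coreHeight n := by
  apply Finset.sup_mono
  intro v
  simp only [Finset.mem_filter]
  rintro ⟨h0, h1, h2⟩
  exact ⟨h0, h1, h2.trans h⟩

theorem reserveTo_succ (n : ℕ) (t : F.V) : F.reserveTo (n + 1) t =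
    F.reserveTo n t + if AdvSlot w (n + 1) ∧ F.label t < n + 1 then 1 else 0 := by
  unfold reserveTo
  rw [← Finset.insert_Icc_right_eq_Icc_add_one (by omega), Finset.filter_insert]
  split_ifs
  · rw [Finset.card_insert_of_notMem (by simp)]
  · rfl

/-- Dropping a last adversarial vertex frees its own slot, which pays for the lost edge. -/
theorem reserveTo_lt {n : ℕ} {t : F.V} (ht : t ≠ F.root) (ha : AdvSlot w (F.label t))
    (hn : F.label t ≤ n) : F.reserveTo n t < F.reserveTo n (F.parent t) := by
  have hlt := F.label_parent_lt t ht
  apply Finset.card_lt_card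
  rw [Finset.ssubset_iff]
  refine ⟨F.label t, by simp, ?_⟩
  intro i
  simp only [Finset.mem_insert, Finset.mem_filter, Finset.mem_Icc]
  rintro (rfl | ⟨h1, h2, h3⟩)
  · exact ⟨⟨ha.1, hn⟩, ha, hlt⟩
  · exact ⟨h1, h2, hlt.trans h3⟩

theorem honestSlot_or_advSlot {i : ℕ} (h1 : 1 ≤ i) (h2 : i ≤ w.length) :
    HonestSlot w i ∨ AdvSlot w i := by
  unfold HonestSlot AdvSlot
  rw [List.getElem?_eq_getElem (by omega)]
  cases w[i - 1] <;> simp [h1]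

theorem not_honestSlot_of_advSlot {i : ℕ} (h : AdvSlot w i) : ¬ HonestSlot w i := by
  rintro ⟨-, h2⟩
  rw [h.2] at h2
  simp at h2

theorem mem_core_of_succ {n : ℕ} (ha : AdvSlot w (n + 1)) {t : F.V} (ht : t ∈ F.core (n + 1)) :
    t ∈ F.core n := by
  rcases ht with rfl | ⟨v, h1, h2, h3⟩
  · exact Or.inl rfl
  · refine Or.inr ⟨v, h1, ?_, h3⟩
    by_contra hlt
    have : F.label v = n + 1 := by omega
    exact not_honestSlot_of_advSlot ha (this ▸ h1)

theorem reachTo_succ_le (n : ℕ) (t : F.V) : F.reachTo (n + 1) t ≤ F.reachTo n t + 1 := by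
  have h1 := F.coreHeight_mono (Nat.le_succ n)
  have h2 := F.reserveTo_succ n t
  unfold reachTo
  split_ifs at h2 <;> simp only [Nat.succ_eq_add_one] at h1 <;> omega

open Classical in
theorem coreHeight_lt_depth {n : ℕ} {v : F.V} (hh : HonestSlot w (n + 1))
    (hv : F.label v = n + 1) : F.coreHeight n < F.depth v := by
  have hr : v ≠ F.root := by
    rintro rfl
    rw [F.label_root] at hv
    omega
  -- If there is no earlier honest vertex, the supremum is `0`; hence the side goal `0 < depth v`.
  refine (Finset.sup_lt_iff ?_).2 ?_
  · rw [F.depth_of_ne_root hr]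
    exact Nat.succ_pos _
  · intro u hu
    obtain ⟨-, h1, h2⟩ := Finset.mem_filter.1 hu
    exact F.honest_depth u v h1 (hv ▸ hh) (by omega)

open Classical in
theorem depth_le_coreHeight {n : ℕ} {v : F.V} (hh : HonestSlot w (F.label v))
    (hv : F.label v ≤ n) : F.depth v ≤ F.coreHeight n :=
  Finset.le_sup (f := F.depth) (Finset.mem_filter.2 ⟨Finset.mem_univ _, hh, hv⟩)

/-- Moving a tine back to its last vertex in the core does not decrease its reserve by less than
its length. -/
theorem exists_core_onTine {n : ℕ} (t : F.V) (ht : F.label t ≤ n) :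
    ∃ u ∈ F.core n, F.OnTine u t ∧
      F.reserveTo n t + F.depth t ≤ F.reserveTo n u + F.depth u := by
  induction h : F.label t using Nat.strong_induction_on generalizing t with
  | _ k ih =>
    by_cases hc : t ∈ F.core n
    · exact ⟨t, hc, F.onTine_refl t, le_rfl⟩
    · have hr : t ≠ F.root := fun h => hc (Or.inl h)
      have hlt := F.label_parent_lt t hr
      obtain ⟨u, hu, hut, hle⟩ := ih _ (h ▸ hlt) (F.parent t) (by omega) rfl
      have ha : AdvSlot w (F.label t) :=
        (honestSlot_or_advSlot (by omega) (F.label_le t)).resolve_left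
          fun hh => hc (Or.inr ⟨t, hh, ht, F.onTine_refl t⟩)
      have h1 := F.reserveTo_lt hr ha ht
      have h2 := F.depth_of_ne_root hr
      exact ⟨u, hu, hut.trans ⟨1, rfl⟩, by omega⟩

/-- The height grows by at least one. A tine ending before the new slot is cut back to the old core
without loss of reserve plus length, so its reach was at least one larger there. Otherwise it ends
at the new honest vertex, with no reserve left; its parent is at least as deep as the old height, so
cutting back from the parent gives an old tine of nonnegative reach. -/
theorem exists_core_of_succ {n : ℕ} (hh : HonestSlot w (n + 1)) {t : F.V}
    (ht : t ∈ F.core (n + 1)) :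
    (∃ u ∈ F.core n, F.OnTine u t ∧ F.reachTo (n + 1) t ≤ F.reachTo n u - 1) ∨
      (F.label t = n + 1 ∧ F.reachTo (n + 1) t ≤ 0 ∧
        ∃ u ∈ F.core n, F.OnTine u t ∧ 0 ≤ F.reachTo n u) := by
  obtain ⟨v, hv, -⟩ := F.honest_unique _ hh
  have hv : F.label v = n + 1 := hv
  have h1 := F.coreHeight_lt_depth hh hv
  have h2 := F.depth_le_coreHeight (hv ▸ hh) hv.le
  have hna : ¬ AdvSlot w (n + 1) := fun h => not_honestSlot_of_advSlot h hh
  have hlab : F.label t ≤ n + 1 := by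
    rcases ht with rfl | ⟨v', -, h', h''⟩
    · simp [F.label_root]
    · rcases h''.eq_or_label_lt with rfl | h3 <;> omega
  rcases hlab.lt_or_eq with hlt | heq
  · left
    obtain ⟨u, hu, hut, hle⟩ := F.exists_core_onTine t (Nat.lt_succ_iff.1 hlt)
    refine ⟨u, hu, hut, ?_⟩
    have h3 := F.reserveTo_succ n t
    rw [if_neg (fun h => hna h.1)] at h3
    unfold reachTo
    omega
  · right
    have hr : t ≠ F.root := by
      rintro rfl
      rw [F.label_root] at heq
      omega
    have htv : t = v := (F.honest_unique _ hh).unique heq hv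
    subst htv
    have hp := F.label_parent_lt t hr
    have hd := F.depth_of_ne_root hr
    obtain ⟨u, hu, hut, hle⟩ := F.exists_core_onTine (n := n) (F.parent t) (by omega)
    have h3 : F.reserveTo (n + 1) t = 0 := by
      unfold reserveTo
      rw [Finset.card_eq_zero, Finset.filter_eq_empty_iff]
      intro i hi
      have := (Finset.mem_Icc.1 hi).2
      omega
    refine ⟨heq, ?_, u, hu, hut.trans ⟨1, rfl⟩, ?_⟩
    · unfold reachTo
      omega
    · unfold reachTo
      omega

theorem reachTo_le_reachWalk {n : ℕ} (hn : n ≤ w.length) {t : F.V} (ht : t ∈ F.core n) :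
    F.reachTo n t ≤ reachWalk (w.take n) := by
  induction n generalizing t with
  | zero =>
    have : t = F.root := by
      rcases ht with h | ⟨v, h1, h2, -⟩
      · exact h
      · have := h1.1
        omega
    subst this
    simp [reachTo, reserveTo, F.depth_root, reachWalk]
  | succ n ih =>
    have hlt : n < w.length := hn
    rw [← List.take_concat_get' w n hlt, reachWalk_append_singleton]
    cases hb : w[n] with
    | true =>
      have ha : AdvSlot w (n + 1) := ⟨by omega, by simp [hb, hlt]⟩
      have h1 := ih hlt.le (F.mem_core_of_succ ha ht)
      have h2 := F.reachTo_succ_le n t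
      simp only [reachStep, if_true]
      omega
    | false =>
      have hh : HonestSlot w (n + 1) := ⟨by omega, by simp [hb, hlt]⟩
      simp only [reachStep, Bool.false_eq_true, if_false]
      rcases F.exists_core_of_succ hh ht with ⟨u, hu, -, h⟩ | ⟨-, h, -⟩
      · have := ih hlt.le hu
        omega
      · omega

/-- The case in which `t₁` ends at the new honest vertex. Its reach is at most `0`, which suffices
when the new bound is nonnegative. Otherwise the old margin bound is negative, or both old bounds
are `0`; as the cut-back of `t₁` has nonnegative reach, the cut-back of `t₂` is then bounded by
`s.2`, and `t₂` loses one more. -/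
theorem min_reachTo_le_of_label_eq {m n : ℕ} (hm : m ≤ n) {t₁ t₂ : F.V} {s : ℤ × ℤ}
    (hh : HonestSlot w (n + 1)) (h₂ : t₂ ∈ F.core (n + 1))
    (hd : F.DisjointAfter m t₁ t₂)
    (hs₁ : ∀ u ∈ F.core n, F.reachTo n u ≤ s.1)
    (hs₂ : ∀ u₁ ∈ F.core n, ∀ u₂ ∈ F.core n, F.DisjointAfter m u₁ u₂ →
      min (F.reachTo n u₁) (F.reachTo n u₂) ≤ s.2)
    (hl : F.label t₁ = n + 1) (hr : F.reachTo (n + 1) t₁ ≤ 0)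
    (hu : ∃ u ∈ F.core n, F.OnTine u t₁ ∧ 0 ≤ F.reachTo n u) :
    min (F.reachTo (n + 1) t₁) (F.reachTo (n + 1) t₂) ≤ (marginStep s false).2 := by
  obtain ⟨u, hu, hut, h0⟩ := hu
  rcases F.exists_core_of_succ hh h₂ with ⟨u', hu', hut', h'⟩ | ⟨hl', -⟩
  · have h1 := hs₂ u hu u' hu' (hd.mono hut hut')
    have h2 := hs₁ u' hu'
    simp only [marginStep, Bool.false_eq_true, if_false]
    split_ifs <;> omega
  -- Two tines ending at the new honest vertex coincide and share its last edge, whose label exceeds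
  -- `m`.
  · have : t₁ = t₂ := (F.honest_unique _ hh).unique hl hl'
    subst this
    refine absurd ⟨t₁, ?_, by omega, F.onTine_refl _, F.onTine_refl _⟩ hd
    rintro rfl
    rw [F.label_root] at hl
    omega

theorem min_reachTo_le_marginWalk {x y : List Bool} (F : Fork (x ++ y)) {n : ℕ}
    (hn : n ≤ y.length) {t₁ t₂ : F.V} (h₁ : t₁ ∈ F.core (x.length + n))
    (h₂ : t₂ ∈ F.core (x.length + n)) (hd : F.DisjointAfter x.length t₁ t₂) :
    min (F.reachTo (x.length + n) t₁) (F.reachTo (x.length + n) t₂)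
      ≤ (marginWalk x (y.take n)).2 := by
  induction n generalizing t₁ t₂ with
  | zero =>
    -- For empty `y` the margin bound is the reach bound, and disjointness plays no role.
    have h := F.reachTo_le_reachWalk (n := x.length) (by simp) h₁
    rw [List.take_left] at h
    exact (min_le_left _ _).trans h
  | succ n ih =>
    have hlt : n < y.length := hn
    have hs₁ : ∀ u ∈ F.core (x.length + n),
        F.reachTo (x.length + n) u ≤ (marginWalk x (y.take n)).1 := by
      intro u hu
      have h := F.reachTo_le_reachWalk (n := x.length + n) (by simp; omega) hu
      rwa [List.take_length_add_append, ← marginWalk_fst] at h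
    have hs₂ := fun u₁ h₁ u₂ h₂ h => @ih hlt.le u₁ u₂ h₁ h₂ h
    have hget : (x ++ y)[x.length + n]? = some y[n] := by simp [hlt]
    rw [← List.take_concat_get' y n hlt, marginWalk_append_singleton]
    rw [← Nat.add_assoc] at h₁ h₂ ⊢
    cases hb : y[n] with
    | true =>
      rw [hb] at hget
      have ha : AdvSlot (x ++ y) (x.length + n + 1) := ⟨by omega, hget⟩
      have h := hs₂ _ (F.mem_core_of_succ ha h₁) _ (F.mem_core_of_succ ha h₂) hd
      have h3 := F.reachTo_succ_le (x.length + n) t₁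
      have h4 := F.reachTo_succ_le (x.length + n) t₂
      simp only [marginStep, if_true]
      omega
    | false =>
      rw [hb] at hget
      have hh : HonestSlot (x ++ y) (x.length + n + 1) := ⟨by omega, hget⟩
      rcases F.exists_core_of_succ hh h₁ with ⟨u₁, hu₁, ht₁, hr₁⟩ | ⟨hl, hr, hu⟩
      · rcases F.exists_core_of_succ hh h₂ with ⟨u₂, hu₂, ht₂, hr₂⟩ | ⟨hl, hr, hu⟩
        · have h := hs₂ _ hu₁ _ hu₂ (hd.mono ht₁ ht₂)
          simp only [marginStep, Bool.false_eq_true, if_false]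
          split_ifs <;> omega
        · rw [min_comm]
          exact F.min_reachTo_le_of_label_eq (Nat.le_add_right _ _) hh h₁ hd.symm hs₁ hs₂ hl hr hu
      · exact F.min_reachTo_le_of_label_eq (Nat.le_add_right _ _) hh h₂ hd hs₁ hs₂ hl hr hu

/-- Climbing through children ends at a leaf, which is honest; labels increase, so the climb
terminates. -/
theorem Closed.mem_core {F : Fork w} (hF : F.Closed) (t : F.V) : t ∈ F.core w.length := by
  rcases hF with hF | hF
  · induction h : w.length - F.label t using Nat.strong_induction_on generalizing t with
    | _ k ih =>
      by_cases hl : F.IsLeaf t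
      · exact Or.inr ⟨t, hF t hl, F.label_le t, F.onTine_refl t⟩
      · unfold IsLeaf at hl
        push Not at hl
        obtain ⟨c, hc, rfl⟩ := hl
        have h1 := F.label_parent_lt c hc
        have h2 := F.label_le c
        obtain ⟨v, h3, h4, h5⟩ := (ih _ (by omega) c rfl).resolve_left hc
        exact Or.inr ⟨v, h3, h4, h5.parent_left⟩
  · exact Or.inl (hF t)

open Classical in
theorem reach_le_reachTo (t : F.V) : F.reach t ≤ F.reachTo w.length t := by
  have h : F.coreHeight w.length ≤ F.height := Finset.sup_mono (Finset.filter_subset _ _)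
  have h' : F.reserveTo w.length t = F.reserve t := rfl
  unfold reach gap reachTo
  omega

end Fork

theorem relMargin_le_marginWalk (x y : List Bool) : relMargin x y ≤ (marginWalk x y).2 := by
  obtain ⟨F, hF, h⟩ := (isGreatest_relMargin x y).1
  obtain ⟨t₁, t₂, hd, h'⟩ := (F.isGreatest_relMargin x.length).1
  rw [h, h']
  have hm : ∀ t, t ∈ F.core (x.length + y.length) := fun t => by
    rw [← List.length_append]
    exact hF.mem_core t
  have h1 := F.min_reachTo_le_marginWalk le_rfl (hm t₁) (hm t₂) hd
  rw [List.take_length, ← List.length_append] at h1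
  exact (min_le_min (F.reach_le_reachTo t₁) (F.reach_le_reachTo t₂)).trans h1

/-! ### A potential that contracts in expectation -/

/-- The potential of a state of the joint walk. -/
noncomputable def potential (α : ℝ) (s : ℤ × ℤ) : ℝ := s.1 + α * min 0 s.2

/-- Monotonicity in the symbol: the martingale condition bounds the probability of `1` only from
above. -/
theorem potential_marginStep_le {α : ℝ} (hα : 0 ≤ α) {s : ℤ × ℤ} (h0 : 0 ≤ s.1) :
    potential α (marginStep s false) ≤ potential α (marginStep s true) := by
  have h1 : (marginStep s false).1 ≤ (marginStep s true).1 := by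
    simp only [marginStep, reachStep, if_true, Bool.false_eq_true, if_false]
    omega
  have h2 : min 0 (marginStep s false).2 ≤ min 0 (marginStep s true).2 := by
    simp only [marginStep, if_true, Bool.false_eq_true, if_false]
    split_ifs <;> omega
  unfold potential
  gcongr

/-- The increments of the potential are bounded, and its drift is negative. -/
theorem exists_potential_increments {ε : ℝ} (hε0 : 0 < ε) (hε1 : ε < 1) {s : ℤ × ℤ}
    (h0 : 0 ≤ s.1) (h1 : s.2 ≤ s.1) : ∃ a b : ℝ,
      potential ε⁻¹ (marginStep s true) = potential ε⁻¹ s + a ∧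
      potential ε⁻¹ (marginStep s false) = potential ε⁻¹ s + b ∧
      |a| ≤ 1 + ε⁻¹ ∧ |b| ≤ 1 + ε⁻¹ ∧
      (1 - ε) / 2 * a + (1 - (1 - ε) / 2) * b ≤ -(ε / 2) := by
  obtain ⟨r, m⟩ := s
  have hi : 1 < ε⁻¹ := (one_lt_inv₀ hε0).2 hε1
  have hm : ε * ε⁻¹ = 1 := mul_inv_cancel₀ hε0.ne'
  simp only at h0 h1
  simp only [potential, marginStep, reachStep, if_true, Bool.false_eq_true, if_false]
  rcases lt_or_ge m 0 with hneg | hpos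
  · have e1 : min 0 m = m := min_eq_right hneg.le
    have e2 : min 0 (m + 1) = m + 1 := min_eq_right (by omega)
    have e3 : min 0 (m - 1) = m - 1 := min_eq_right (by omega)
    rw [if_neg (by omega), e1, e2, e3]
    rcases h0.eq_or_lt with rfl | hr
    -- Here `r` is reflected and drifts up by `(1 - ε) / 2`; the weight `ε⁻¹` turns the margin drift
    -- `-ε` into `-1`, which outweighs it.
    · refine ⟨1 + ε⁻¹, -ε⁻¹, by push_cast; ring, by push_cast; norm_num; ring, ?_, ?_, ?_⟩
      · rw [abs_of_nonneg] <;> linarith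
      · rw [abs_neg, abs_of_nonneg] <;> linarith
      · nlinarith
    · refine ⟨1 + ε⁻¹, -(1 + ε⁻¹), by push_cast; ring, ?_, ?_, ?_, ?_⟩
      · rw [max_eq_left (by omega)]
        push_cast
        ring
      · rw [abs_of_nonneg] <;> linarith
      · rw [abs_neg, abs_of_nonneg] <;> linarith
      · nlinarith
  · have e1 : min 0 m = 0 := min_eq_left hpos
    have e2 : min 0 (m + 1) = 0 := min_eq_left (by omega)
    rw [e1, e2]
    rcases h0.eq_or_lt with rfl | hr
    · obtain rfl : m = 0 := by omega
      refine ⟨1, -ε⁻¹, by push_cast; ring, by norm_num, ?_, ?_, ?_⟩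
      · rw [abs_one]
        linarith
      · rw [abs_neg, abs_of_nonneg] <;> linarith
      · nlinarith
    · have e3 : min 0 (if m = 0 ∧ 0 < r then 0 else m - 1) = 0 := by
        split_ifs <;> omega
      refine ⟨1, -1, by push_cast; ring, ?_, ?_, ?_, ?_⟩
      · rw [e3, max_eq_left (by omega)]
        push_cast
        ring
      · rw [abs_one]
        linarith
      · rw [abs_neg, abs_one]
        linarith
      · linarith

theorem exp_le_one_add_add_sq {x : ℝ} (hx : |x| ≤ 1) : Real.exp x ≤ 1 + x + x ^ 2 := by
  have := (abs_le.1 (Real.abs_exp_sub_one_sub_id_le hx)).2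
  linarith

/-- A bounded increment with negative drift contracts a small exponential moment. -/
theorem exp_contraction {p δ K l a b φ : ℝ} (hp0 : 0 ≤ p) (hp1 : p ≤ 1) (hl : 0 ≤ l)
    (hlK : l * K ≤ 1) (ha : |a| ≤ K) (hb : |b| ≤ K) (hd : p * a + (1 - p) * b ≤ -δ) :
    p * Real.exp (l * (φ + a)) + (1 - p) * Real.exp (l * (φ + b))
      ≤ (1 - l * δ + (l * K) ^ 2) * Real.exp (l * φ) := by
  have key : ∀ {c}, |c| ≤ K → Real.exp (l * c) ≤ 1 + l * c + (l * K) ^ 2 := by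
    intro c hc
    have h : |l * c| ≤ l * K := by
      rw [abs_mul, abs_of_nonneg hl]
      gcongr
    have h1 := exp_le_one_add_add_sq (h.trans hlK)
    have h2 := sq_le_sq' (abs_le.1 h).1 (abs_le.1 h).2
    linarith
  have h1 := mul_le_mul_of_nonneg_left (key ha) hp0
  have h2 := mul_le_mul_of_nonneg_left (key hb) (sub_nonneg.2 hp1)
  have h3 := mul_le_mul_of_nonneg_left hd hl
  rw [mul_add, mul_add, Real.exp_add, Real.exp_add]
  have h4 := mul_le_mul_of_nonneg_right
    (show p * Real.exp (l * a) + (1 - p) * Real.exp (l * b) ≤ 1 - l * δ + (l * K) ^ 2 by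
      linarith) (Real.exp_pos (l * φ)).le
  linarith

/-- Constants for which one slot contracts the exponential moments of the joint walk, and of the
reach walk up to a constant. -/
theorem exists_contraction {ε : ℝ} (hε0 : 0 < ε) (hε1 : ε < 1) :
    ∃ l q : ℝ, 0 < l ∧ 0 < q ∧ q < 1 ∧
      (∀ s : ℤ × ℤ, 0 ≤ s.1 → s.2 ≤ s.1 →
        (1 - ε) / 2 * Real.exp (l * potential ε⁻¹ (marginStep s true)) +
          (1 - (1 - ε) / 2) * Real.exp (l * potential ε⁻¹ (marginStep s false))
          ≤ q * Real.exp (l * potential ε⁻¹ s)) ∧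
      ∀ r : ℤ, 0 ≤ r →
        (1 - ε) / 2 * Real.exp (l * reachStep r true) +
          (1 - (1 - ε) / 2) * Real.exp (l * reachStep r false)
          ≤ q * Real.exp (l * r) + Real.exp l := by
  have hi : 1 < ε⁻¹ := (one_lt_inv₀ hε0).2 hε1
  set K := 1 + ε⁻¹ with hK
  have hK2 : 2 < K := by linarith
  -- Chosen so that the quadratic error `(l * K) ^ 2 = l * ε / 4` is half the linear gain `l * ε /
  -- 2`.
  set l := ε / (4 * K ^ 2) with hl
  have hl0 : 0 < l := by positivity
  have hlK : l * K ^ 2 = ε / 4 := by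
    rw [hl]
    field_simp
  have hlK' : l * K ≤ 1 := by nlinarith
  have hl1 : l ≤ ε / 4 := by
    rw [← hlK]
    exact le_mul_of_one_le_right hl0.le (one_le_pow₀ (by linarith))
  have hq : 1 - l * (ε / 2) + (l * K) ^ 2 = 1 - l * (ε / 4) := by
    linear_combination l * hlK
  refine ⟨l, 1 - l * (ε / 4), hl0, by nlinarith, by nlinarith, ?_, ?_⟩
  · intro s h0 h1
    obtain ⟨a, b, ha, hb, ha', hb', hd⟩ := exists_potential_increments hε0 hε1 h0 h1
    rw [ha, hb, ← hq]
    exact exp_contraction (by linarith) (by linarith) hl0.le hlK' ha' hb' hd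
  · intro r hr
    simp only [reachStep, if_true, Bool.false_eq_true, if_false]
    rcases hr.eq_or_lt with rfl | hr
    -- At the reflecting barrier there is no contraction; the additive `Real.exp l` absorbs this
    -- state.
    · have h1 : 1 ≤ Real.exp l := Real.one_le_exp hl0.le
      norm_num
      nlinarith
    · rw [max_eq_left (by omega)]
      push_cast
      have h := exp_contraction (p := (1 - ε) / 2) (δ := ε / 2) (φ := (r : ℝ)) (a := 1) (b := -1)
        (by linarith) (by linarith) hl0.le hlK' (by rw [abs_one]; linarith)
        (by rw [abs_neg, abs_one]; linarith) (by linarith)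
      rw [hq] at h
      exact h.trans (le_add_of_nonneg_right (Real.exp_pos l).le)

/-! ### Integration along the martingale condition -/

theorem integral_mul_le_of_condExp_le {Ω : Type*} {m m₀ : MeasurableSpace Ω} {P : Measure Ω}
    [IsFiniteMeasure P] (hm : m ≤ m₀) {D X : Ω → ℝ} {p : ℝ} (hDm : StronglyMeasurable[m] D)
    (hD0 : 0 ≤ D) (hD : Integrable D P) (hX : Integrable X P) (hDX : Integrable (D * X) P)
    (hp : P[X | m] ≤ᵐ[P] fun _ => p) : ∫ ω, D ω * X ω ∂P ≤ ∫ ω, D ω * p ∂P := by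
  change ∫ ω, (D * X) ω ∂P ≤ _
  rw [← integral_condExp hm]
  refine integral_mono_ae integrable_condExp (hD.mul_const _) ?_
  filter_upwards [condExp_mul_of_stronglyMeasurable_left hDm hDX hX, hp] with ω h1 h2
  rw [h1]
  exact mul_le_mul_of_nonneg_left h2 (hD0 ω)

theorem measurable_comp_take_ofFn {Ω : Type*} {T : ℕ} (W : Ω → Fin T → Bool) (t : Fin T)
    (g : List Bool → ℝ) :
    Measurable[MeasurableSpace.comap (fun ω (i : {i : Fin T // i < t}) => W ω i) inferInstance]
      fun ω => g ((List.ofFn (W ω)).take t) := by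
  have h : (fun ω => g ((List.ofFn (W ω)).take t)) =
      (fun a : {i : Fin T // i < t} → Bool =>
        g (List.ofFn fun j : Fin t => a ⟨⟨j, j.2.trans t.2⟩, j.2⟩)) ∘
      fun ω (i : {i : Fin T // i < t}) => W ω i := by
    funext ω
    simp only [Function.comp_apply]
    congr 1
    apply List.ext_getElem
    · simp
    · intro i h1 h2
      simp
  rw [h]
  exact (Measurable.of_discrete).comp (comap_measurable _)

section Martingale

variable {Ω : Type*} [MeasurableSpace Ω] {P : Measure Ω} [IsProbabilityMeasure P] {T : ℕ}
  {W : Ω → Fin T → Bool} {ε : ℝ}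

theorem integrable_comp_ofFn (hW : Measurable W) (g : List Bool → ℝ) :
    Integrable (fun ω => g (List.ofFn (W ω))) P :=
  (Integrable.of_finite (μ := P.map W) (f := fun a => g (List.ofFn a))).comp_measurable hW

/-- One slot of the martingale condition, for functions of the prefix that are monotone in the last
symbol. -/
theorem EpsMartingale.integral_take_succ_le (hM : EpsMartingale P W ε) (hW : Measurable W)
    {n : ℕ} (hn : n < T) {g h : List Bool → ℝ}
    (hg : ∀ x : List Bool, x.length = n → g (x ++ [false]) ≤ g (x ++ [true]))
    (hh : ∀ x : List Bool, x.length = n →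
      (1 - ε) / 2 * g (x ++ [true]) + (1 - (1 - ε) / 2) * g (x ++ [false]) ≤ h x) :
    ∫ ω, g ((List.ofFn (W ω)).take (n + 1)) ∂P ≤ ∫ ω, h ((List.ofFn (W ω)).take n) ∂P := by
  set t : Fin T := ⟨n, hn⟩ with ht
  have hm : MeasurableSpace.comap (fun ω (i : {i : Fin T // i < t}) => W ω i) inferInstance
      ≤ ‹MeasurableSpace Ω› :=
    (measurable_pi_iff.2 fun i => (measurable_pi_apply _).comp hW).comap_le
  set X : Ω → ℝ := fun ω => if W ω t = true then (1 : ℝ) else 0 with hX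
  let d : List Bool → ℝ := fun x => g (x ++ [true]) - g (x ++ [false])
  have hint : ∀ f : List Bool → ℝ, ∀ j, Integrable (fun ω => f ((List.ofFn (W ω)).take j)) P :=
    fun f j => integrable_comp_ofFn hW fun x => f (x.take j)
  set D : Ω → ℝ := fun ω => d ((List.ofFn (W ω)).take n) with hD
  have hlen : ∀ ω, ((List.ofFn (W ω)).take n).length = n := fun ω => by simp [hn.le]
  have hsplit : ∀ ω, (List.ofFn (W ω)).take (n + 1) = (List.ofFn (W ω)).take n ++ [W ω t] := by
    intro ω
    rw [← List.take_concat_get' _ n (by simpa using hn)]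
    simp [ht]
  -- Affine in the last symbol, with a slope `D ≥ 0` known from the prefix, so the one-sided bound
  -- on the conditional mean can be inserted.
  have heq : ∀ ω, g ((List.ofFn (W ω)).take (n + 1)) =
      g ((List.ofFn (W ω)).take n ++ [false]) + D ω * X ω := by
    intro ω
    rw [hsplit]
    cases hb : W ω t <;> simp [hX, hD, d, hb]
  have hXi : Integrable X P := by
    have := (Integrable.of_finite (μ := P.map W)
      (f := fun a : Fin T → Bool => if a t = true then (1 : ℝ) else 0)).comp_measurable hW
    exact this
  have hDXi : Integrable (D * X) P := by
    have := (hint g (n + 1)).sub (hint (fun x => g (x ++ [false])) n)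
    refine this.congr (Filter.Eventually.of_forall fun ω => ?_)
    simp only [Pi.sub_apply, Pi.mul_apply, heq]
    ring
  have hpull : ∫ ω, D ω * X ω ∂P ≤ ∫ ω, D ω * ((1 - ε) / 2) ∂P :=
    integral_mul_le_of_condExp_le hm (measurable_comp_take_ofFn W t d).stronglyMeasurable
      (fun ω => sub_nonneg.2 (hg _ (hlen ω))) (hint d n) hXi hDXi (hM t)
  have hadd : ∫ ω, g ((List.ofFn (W ω)).take (n + 1)) ∂P =
      ∫ ω, g ((List.ofFn (W ω)).take n ++ [false]) ∂P + ∫ ω, D ω * X ω ∂P := by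
    simp only [heq]
    exact integral_add (hint (fun x => g (x ++ [false])) n) hDXi
  rw [hadd]
  refine (add_le_add_right hpull _).trans ?_
  rw [← integral_add (hint (fun x => g (x ++ [false])) n) ((hint d n).mul_const _)]
  refine integral_mono
    ((hint (fun x => g (x ++ [false])) n).add ((hint d n).mul_const _)) (hint h n) fun ω => ?_
  have := hh _ (hlen ω)
  simp only [d]
  linarith

theorem EpsMartingale.integral_exp_reachWalk_le (hM : EpsMartingale P W ε) (hW : Measurable W)
    {l q : ℝ} (hl : 0 < l) (hq0 : 0 < q) (hq1 : q < 1)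
    (hr : ∀ r : ℤ, 0 ≤ r →
        (1 - ε) / 2 * Real.exp (l * reachStep r true) +
          (1 - (1 - ε) / 2) * Real.exp (l * reachStep r false)
          ≤ q * Real.exp (l * r) + Real.exp l)
    {n : ℕ} (hn : n ≤ T) :
    ∫ ω, Real.exp (l * reachWalk ((List.ofFn (W ω)).take n)) ∂P ≤ 1 + Real.exp l / (1 - q) := by
  have hq : 0 < 1 - q := sub_pos.2 hq1
  induction n with
  | zero =>
    simp only [List.take_zero, reachWalk, List.foldl_nil, Int.cast_zero, mul_zero, Real.exp_zero,
      integral_const, probReal_univ, smul_eq_mul, mul_one]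
    have := div_pos (Real.exp_pos l) hq
    linarith
  | succ n ih =>
    have hi := integrable_comp_ofFn (P := P) hW fun x => Real.exp (l * reachWalk (x.take n))
    have h := hM.integral_take_succ_le hW hn (g := fun x => Real.exp (l * reachWalk x))
      (h := fun x => q * Real.exp (l * reachWalk x) + Real.exp l)
      (fun x _ => by
        simp only [reachWalk_append_singleton]
        have : reachStep (reachWalk x) false ≤ reachStep (reachWalk x) true := by
          have := reachWalk_nonneg x
          simp only [reachStep, if_true, Bool.false_eq_true, if_false]
          omega
        gcongr)
      (fun x _ => by
        simp only [reachWalk_append_singleton]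
        exact hr _ (reachWalk_nonneg x))
    rw [integral_add (hi.const_mul q) (integrable_const _), integral_const_mul] at h
    simp only [integral_const, probReal_univ, smul_eq_mul, one_mul] at h
    have h' := mul_le_mul_of_nonneg_left (ih (by omega)) hq0.le
    -- `Real.exp l / (1 - q)` is the fixed point of `v ↦ q * v + Real.exp l`, so the bound
    -- reproduces itself.
    have h3 : Real.exp l = Real.exp l / (1 - q) * (1 - q) := by field_simp
    nlinarith

theorem EpsMartingale.integral_exp_potential_le (hM : EpsMartingale P W ε) (hW : Measurable W)
    {l q α B : ℝ} (hl : 0 < l) (hq0 : 0 < q) (hα : 0 ≤ α)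
    (hs : ∀ s : ℤ × ℤ, 0 ≤ s.1 → s.2 ≤ s.1 →
        (1 - ε) / 2 * Real.exp (l * potential α (marginStep s true)) +
          (1 - (1 - ε) / 2) * Real.exp (l * potential α (marginStep s false))
          ≤ q * Real.exp (l * potential α s))
    {m n : ℕ} (hn : m + n ≤ T)
    (hB : ∫ ω, Real.exp (l * reachWalk ((List.ofFn (W ω)).take m)) ∂P ≤ B) :
    ∫ ω, Real.exp (l * potential α (marginWalk ((List.ofFn (W ω)).take m)
      (((List.ofFn (W ω)).take (m + n)).drop m))) ∂P ≤ q ^ n * B := by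
  induction n with
  | zero =>
    rw [pow_zero, one_mul]
    refine le_of_eq_of_le (integral_congr_ae (Filter.Eventually.of_forall fun ω => ?_)) hB
    -- At the end of `x` the margin equals the reach, which is nonnegative, so the potential is the
    -- reach.
    simp [marginWalk, potential, reachWalk_nonneg]
  | succ n ih =>
    have h := hM.integral_take_succ_le hW (n := m + n) (by omega)
      (g := fun x => Real.exp (l * potential α (marginWalk (x.take m) (x.drop m))))
      (h := fun x => q * Real.exp (l * potential α (marginWalk (x.take m) (x.drop m))))
      (fun x hx => by
        have hx' : m ≤ x.length := by omega
        simp only [List.take_append_of_le_length hx', List.drop_append_of_le_length hx',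
          marginWalk_append_singleton]
        have h0 := reachWalk_nonneg (x.take m ++ x.drop m)
        rw [← marginWalk_fst] at h0
        have := potential_marginStep_le hα h0
        gcongr)
      (fun x hx => by
        have hx' : m ≤ x.length := by omega
        simp only [List.take_append_of_le_length hx', List.drop_append_of_le_length hx',
          marginWalk_append_singleton]
        refine hs _ ?_ (marginWalk_snd_le_fst _ _)
        rw [marginWalk_fst]
        exact reachWalk_nonneg _)
    simp only [List.take_take, ← Nat.add_assoc, integral_const_mul,
      min_eq_left (show m ≤ m + n + 1 by omega), min_eq_left (Nat.le_add_right m n)] at h ⊢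
    refine h.trans ?_
    rw [pow_succ', mul_assoc]
    exact mul_le_mul_of_nonneg_left (ih (by omega)) hq0.le

end Martingale

/-! ### Markov's inequality and the union bound over the length of `y` -/

theorem corollary2 (ε : ℝ) (hε0 : 0 < ε) (hε1 : ε < 1) :
    ∃ C c : ℝ, 0 < C ∧ 0 < c ∧
      ∀ (T s k : ℕ) (Ω : Type*) [MeasurableSpace Ω] (P : Measure Ω) [IsProbabilityMeasure P]
        (W : Ω → Fin T → Bool), Measurable W → EpsMartingale P W ε →
        P.real {ω | ∃ x y z : List Bool, List.ofFn (W ω) = x ++ y ++ z ∧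
            x.length + 1 = s ∧ k ≤ y.length ∧ 0 ≤ relMargin x y}
          ≤ C * Real.exp (-(c * k)) := by
  obtain ⟨l, q, hl, hq0, hq1, hs, hr⟩ := exists_contraction hε0 hε1
  have hq : 0 < 1 - q := sub_pos.2 hq1
  set B := 1 + Real.exp l / (1 - q) with hB
  have hB0 : 0 < B := by positivity
  refine ⟨B / (1 - q), -Real.log q, by positivity, neg_pos.2 (Real.log_neg hq0 hq1), ?_⟩
  intro T s k Ω _ P _ W hW hM
  have hexp : Real.exp (-(-Real.log q * k)) = q ^ k := by
    rw [neg_mul, neg_neg, mul_comm, Real.exp_nat_mul, Real.exp_log hq0]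
  rw [hexp]
  let Z : ℕ → Ω → ℝ := fun n ω => Real.exp (l * potential ε⁻¹
    (marginWalk ((List.ofFn (W ω)).take (s - 1))
      (((List.ofFn (W ω)).take (s - 1 + n)).drop (s - 1))))
  -- For `s = 0` the event is empty, so the truncation in `s - 1` is harmless.
  have hsub : {ω | ∃ x y z : List Bool, List.ofFn (W ω) = x ++ y ++ z ∧
      x.length + 1 = s ∧ k ≤ y.length ∧ 0 ≤ relMargin x y} ⊆
      ⋃ n ∈ (Finset.range (T + 1)).filter fun n => k ≤ n ∧ s - 1 + n ≤ T, {ω | 1 ≤ Z n ω} := by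
    rintro ω ⟨x, y, z, hxyz, rfl, hk, hmu⟩
    have hlen : x.length + y.length + z.length = T := by
      have := congrArg List.length hxyz
      simp at this
      omega
    simp only [Set.mem_iUnion, Finset.mem_filter, Finset.mem_range, Set.mem_ofPred_eq]
    refine ⟨y.length, ⟨by omega, hk, by omega⟩, ?_⟩
    have h1 : (x ++ y ++ z).take (x.length + 1 - 1) = x := by simp
    have h2 : ((x ++ y ++ z).take (x.length + 1 - 1 + y.length)).drop (x.length + 1 - 1) = y := by
      rw [Nat.add_sub_cancel, ← List.length_append, List.take_left, List.drop_left]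
    simp only [Z, hxyz, h1, h2]
    apply Real.one_le_exp
    have h3 := hmu.trans (relMargin_le_marginWalk x y)
    have h4 : (0 : ℝ) ≤ (marginWalk x y).1 := by
      rw [marginWalk_fst]
      exact_mod_cast reachWalk_nonneg _
    rw [potential, min_eq_left h3, Int.cast_zero, mul_zero, add_zero]
    positivity
  have hZ : ∀ n, s - 1 + n ≤ T → P.real {ω | 1 ≤ Z n ω} ≤ q ^ n * B := by
    intro n hn
    have h1 := mul_meas_ge_le_integral_of_nonneg (μ := P) (f := Z n)
      (Filter.Eventually.of_forall fun ω => (Real.exp_pos _).le)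
      (integrable_comp_ofFn hW fun x => Real.exp (l * potential ε⁻¹
        (marginWalk (x.take (s - 1)) ((x.take (s - 1 + n)).drop (s - 1))))) 1
    rw [one_mul] at h1
    exact h1.trans (hM.integral_exp_potential_le hW hl hq0 (by positivity) hs hn
      (hM.integral_exp_reachWalk_le hW hl hq0 hq1 hr (by omega)))
  calc _ ≤ _ := measureReal_mono hsub (measure_ne_top _ _)
    _ ≤ _ := measureReal_biUnion_finset_le _ _
    _ ≤ ∑ n ∈ (Finset.range (T + 1)).filter fun n => k ≤ n ∧ s - 1 + n ≤ T, q ^ n * B :=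
      Finset.sum_le_sum fun n hn => hZ n (Finset.mem_filter.1 hn).2.2
    _ ≤ ∑ n ∈ Finset.Ico k (T + 1), q ^ n * B := by
      refine Finset.sum_le_sum_of_subset_of_nonneg ?_ fun _ _ _ => by positivity
      intro n
      simp only [Finset.mem_filter, Finset.mem_range, Finset.mem_Ico]
      tauto
    _ = (∑ n ∈ Finset.Ico k (T + 1), q ^ n) * B := by rw [Finset.sum_mul]
    _ ≤ q ^ k / (1 - q) * B := by
      gcongr
      exact geom_sum_Ico_le_of_lt_one hq0.le hq1
    _ = B / (1 - q) * q ^ k := by ring
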